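/- Let $T$ be a tree on $n \ge 3$ vertices with $p$ leaves (vertices of degree $1$), and let $d_{x,y}$ denote the distance in $T$ between vertices $x$ and $y$. Let $\mathrm{Max4PC}_T$ be the $\binom n2 \times \binom n2$ integer matrix whose rows and columns are indexed by the unordered pairs of distinct vertices of $T$ and whose entry in row $\{w,x\}$ and column $\{y,z\}$ is $$\max\{\, d_{w,x}+d_{y,z},\ d_{w,y}+d_{x,z},\ d_{w,z}+d_{x,y} \,\}.$$ Then the invariant factors of $\mathrm{Max4PC}_T$ over $\mathbb Z$ (the diagonal entries of its Smith normal form, that is, of the diagonal matrix with nonnegative entries, each dividing the next, obtained from $\mathrm{Max4PC}_T$ by multiplying on the left and on the right by matrices invertible over $\mathbb Z$) are, in the order of divisibility, $$1,\ 1,\ \underbrace{2,\dots,2}_{2(n-p-1)},\ \underbrace{0,\dots,0}_{\binom n2-2(n-p)}.$$ -/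

import Mathlib

/-- The two-element subsets of `V`, as non-diagonal unordered pairs. -/
abbrev VertexPair (V : Type*) : Type _ := {e : Sym2 V // ¬ e.IsDiag}

/-- The maximum of the three sums `d(w,x) + d(y,z)`, `d(w,y) + d(x,z)`, `d(w,z) + d(x,y)`,
as a function of the unordered pairs `{w,x}` and `{y,z}`. -/
noncomputable def SimpleGraph.max4PCEntry {V : Type*} (T : SimpleGraph V) : Sym2 V → Sym2 V → ℕ :=
  Sym2.lift₂ ⟨fun w x y z =>
    max (T.dist w x + T.dist y z) (max (T.dist w y + T.dist x z) (T.dist w z + T.dist x y)), by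
      intro w x y z
      refine ⟨?_, ?_⟩
      · dsimp only
        rw [T.dist_comm (u := w) (v := x), max_comm (T.dist w y + T.dist x z),
          add_comm (T.dist w z), add_comm (T.dist w y)]
      · dsimp only
        rw [T.dist_comm (u := y) (v := z), max_comm (T.dist w y + T.dist x z)]⟩

/-- The maximum four point condition matrix, with integer entries; its rows and columns are
indexed by the pairs of distinct vertices. -/
noncomputable def SimpleGraph.max4PC {V : Type*} (T : SimpleGraph V) :
    Matrix (VertexPair V) (VertexPair V) ℤ :=
  Matrix.of fun e f => (T.max4PCEntry e.1 f.1 : ℤ)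

/-- `l` is the list of invariant factors over `ℤ` of the square matrix `M`, in the order of
divisibility (so zeros come last): `l` has one entry for each row of `M`, the entries are
nonnegative, each divides the next, and `M` is carried to the diagonal matrix with diagonal `l`
by multiplication on the left and on the right by matrices that are invertible over `ℤ`. -/
structure Matrix.HasInvariantFactors {ι : Type*} [Fintype ι] [DecidableEq ι]
    (M : Matrix ι ι ℤ) (l : List ℤ) : Prop where
  length_eq : l.length = Fintype.card ι
  nonneg : ∀ a ∈ l, 0 ≤ a
  chain : l.IsChain (· ∣ ·)
  exists_equiv : ∃ (P Q : GL ι ℤ) (e : ι ≃ Fin l.length),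
    (P : Matrix ι ι ℤ) * M * (Q : Matrix ι ι ℤ) = Matrix.diagonal fun i => l.get (e i)

/-! Each dart (oriented edge) splits the tree into a head side and a tail side. For vertices `w, x,
y, z`, the three distance sums plus twice the number of edges realising the corresponding split
`{w,x} | {y,z}` agree, and at most one of the three splits is realised by any edge. Hence the
maximum is `d(w,x) + d(y,z)` plus twice the separation count (`IsTree.max4PCEntry_eq`).

That count is a sum over darts of products of pair indicators. Darts at leaves contribute nothing,
since a pair of distinct vertices does not fit on a one-vertex side. So the matrix is `B * D * B'ᵀ`,
where `B` has columns `1`, distance and one per inner dart, `D = diag(1, 1, 2, ..., 2)`, and `B'`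
permutes the columns of `B` (`IsTree.max4PC_eq`). The rows of `B` generate the whole integer lattice
(`range_vecMulLinear_pairMatrix`), so `B` has a left inverse and extends to a unimodular matrix;
this leaves `D` padded with zeros. -/

namespace SimpleGraph

/-! ### Sides of an edge -/

variable {V : Type*} {T : SimpleGraph V}

/-- The vertices on the head side of a dart: those still reachable from its head once the
underlying edge is deleted. -/
def Dart.HeadSide (a : T.Dart) (v : V) : Prop :=
  (T.deleteEdges {a.edge}).Reachable a.snd v

namespace Dart

theorem headSide_snd (a : T.Dart) : a.HeadSide a.snd := Reachable.refl _

theorem headSide_congr (a : T.Dart) {v w : V} (h : T.Adj v w) (hne : s(v, w) ≠ a.edge) :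
    a.HeadSide v ↔ a.HeadSide w := by
  have hadj : (T.deleteEdges {a.edge}).Adj v w := by
    rw [deleteEdges_adj]
    exact ⟨h, hne⟩
  exact ⟨fun hv => hv.trans hadj.reachable, fun hw => hw.trans hadj.symm.reachable⟩

theorem headSide_or_headSide_symm (hT : T.Connected) (a : T.Dart) (v : V) :
    a.HeadSide v ∨ a.symm.HeadSide v := by
  obtain ⟨y, hy⟩ : ∃ y, y = a.snd := ⟨_, rfl⟩
  obtain ⟨p⟩ := hT v y
  induction p with
  | nil => exact .inl (hy ▸ a.headSide_snd)
  | @cons u w _ h p ih =>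
    by_cases he : s(u, w) = a.edge
    · have he : s(u, w) = s(a.fst, a.snd) := he
      rw [Sym2.eq_iff] at he
      rcases he with he | he
      · right
        have : u = a.symm.snd := he.1
        rw [this]
        exact headSide_snd _
      · left
        have : u = a.snd := he.1
        rw [this]
        exact headSide_snd _
    · have he' : s(u, w) ≠ a.symm.edge := by rwa [Dart.edge_symm]
      rw [a.headSide_congr h he, a.symm.headSide_congr h he']
      exact ih hy

theorem headSide_symm_iff (hT : T.IsTree) (a : T.Dart) (v : V) :
    a.symm.HeadSide v ↔ ¬ a.HeadSide v := by
  constructor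
  · intro h h'
    have hb : T.IsBridge s(a.fst, a.snd) :=
      isAcyclic_iff_forall_isBridge.1 hT.isAcyclic (e := s(a.fst, a.snd)) a.adj
    rw [isBridge_iff] at hb
    unfold HeadSide at h h'
    rw [Dart.edge_symm] at h
    exact hb (h.trans h'.symm)
  · exact (a.headSide_or_headSide_symm hT.connected v).resolve_left

theorem not_headSide_fst (hT : T.IsTree) (a : T.Dart) : ¬ a.HeadSide a.fst :=
  (a.headSide_symm_iff hT _).1 a.symm.headSide_snd

/-- An edge whose ends lie off the head side of `a` does not separate the head side of `a`. -/
theorem headSide_iff_of_not_headSide {a b : T.Dart} (h₁ : ¬ a.HeadSide b.fst)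
    (h₂ : ¬ a.HeadSide b.snd) {v : V} (hv : a.HeadSide v) :
    b.HeadSide v ↔ b.HeadSide a.snd := by
  suffices H : ∀ u w, (T.deleteEdges {a.edge}).Walk u w → a.HeadSide u →
      (b.HeadSide u ↔ b.HeadSide w) by
    obtain ⟨p⟩ := hv
    exact (H _ _ p a.headSide_snd).symm
  intro u w p
  induction p with
  | nil => intro _; rfl
  | @cons u w _ h p ih =>
    intro hu
    have hne : s(u, w) ≠ b.edge := by
      intro he
      have he : s(u, w) = s(b.fst, b.snd) := he
      rw [Sym2.eq_iff] at he
      rcases he with he | he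
      · exact h₁ ((he.1 : u = b.fst) ▸ hu)
      · exact h₂ ((he.1 : u = b.snd) ▸ hu)
    have hw : a.HeadSide w := hu.trans h.reachable
    exact (b.headSide_congr (deleteEdges_le _ h) hne).trans (ih hw)

/-- Among the four intersections of the sides of two edges of a tree, one is empty. -/
theorem not_crossing (hT : T.IsTree) {a b : T.Dart} {w x y z : V}
    (haw : a.HeadSide w) (hax : a.HeadSide x) (hay : ¬ a.HeadSide y) (haz : ¬ a.HeadSide z)
    (hbw : b.HeadSide w) (hbx : ¬ b.HeadSide x) (hby : b.HeadSide y) (hbz : ¬ b.HeadSide z) :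
    False := by
  have hne : s(b.fst, b.snd) ≠ a.edge := by
    intro he
    have : b = a ∨ b = a.symm := (dart_edge_eq_iff b a).1 he
    rcases this with rfl | rfl
    · exact hbx hax
    · exact (a.headSide_symm_iff hT w).1 hbw haw
  have hc := a.headSide_congr b.adj hne
  -- The edge of `b` lies wholly on one side of `a`, so `b` cannot separate the two vertices on the
  -- other side.
  by_cases h : a.HeadSide b.fst
  · have h₁ : ¬ a.symm.HeadSide b.fst := by rwa [headSide_symm_iff hT, not_not]
    have h₂ : ¬ a.symm.HeadSide b.snd := by rwa [headSide_symm_iff hT, not_not, ← hc]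
    exact hbz ((headSide_iff_of_not_headSide h₁ h₂ ((headSide_symm_iff hT _ _).2 haz)).2
      ((headSide_iff_of_not_headSide h₁ h₂ ((headSide_symm_iff hT _ _).2 hay)).1 hby))
  · have h₂ : ¬ a.HeadSide b.snd := by rwa [← hc]
    exact hbx ((headSide_iff_of_not_headSide h h₂ hax).2
      ((headSide_iff_of_not_headSide h h₂ haw).1 hbw))

open Classical in
/-- The indicator function of the head side of a dart. -/
noncomputable def headInd (a : T.Dart) (v : V) : ℤ := if a.HeadSide v then 1 else 0

theorem headInd_eq_one {a : T.Dart} {v : V} (h : a.HeadSide v) : a.headInd v = 1 := if_pos h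

theorem headInd_eq_zero {a : T.Dart} {v : V} (h : ¬ a.HeadSide v) : a.headInd v = 0 := if_neg h

theorem headInd_symm (hT : T.IsTree) (a : T.Dart) (v : V) :
    a.symm.headInd v = 1 - a.headInd v := by
  by_cases h : a.HeadSide v
  · rw [headInd_eq_one h, headInd_eq_zero (by rwa [headSide_symm_iff hT, not_not]), sub_self]
  · rw [headInd_eq_zero h, headInd_eq_one ((headSide_symm_iff hT _ _).2 h), sub_zero]

theorem headInd_congr (a : T.Dart) {v w : V} (h : T.Adj v w) (hne : s(v, w) ≠ a.edge) :
    a.headInd v = a.headInd w := by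
  by_cases hv : a.HeadSide v
  · rw [headInd_eq_one hv, headInd_eq_one ((a.headSide_congr h hne).1 hv)]
  · rw [headInd_eq_zero hv, headInd_eq_zero (mt (a.headSide_congr h hne).2 hv)]

theorem sum_symm [Fintype V] [DecidableRel T.Adj] (f : T.Dart → ℤ) :
    ∑ a, f (Dart.symm a) = ∑ a, f a :=
  Equiv.sum_comp (Function.Involutive.toPerm _ Dart.symm_involutive) f

end Dart

/-! ### Distances, separation counts and the four point maximum -/

section Dist

variable [Fintype V] [DecidableRel T.Adj]

/-- The summand is 1 exactly when the edge separates the ends, and both darts of an edge count. The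
first step of a path changes only the terms of its own two darts, as the rest of the path never
recrosses that edge. -/
theorem Walk.IsPath.two_mul_length_eq_sum (hT : T.IsTree) {v w : V} {p : T.Walk v w}
    (hp : p.IsPath) : 2 * (p.length : ℤ) = ∑ a : T.Dart, (a.headInd v - a.headInd w) ^ 2 := by
  classical
  induction p with
  | nil => simp
  | @cons u v w h p ih =>
    rw [Walk.cons_isPath_iff] at hp
    set b : T.Dart := ⟨(u, v), h⟩ with hb
    have hbw : b.HeadSide w := by
      refine (p.toDeleteEdge b.edge fun hmem => hp.2 ?_).reachable
      exact p.fst_mem_support_of_mem_edges hmem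
    have hbv : b.HeadSide v := b.headSide_snd
    have hbu : ¬ b.HeadSide u := b.not_headSide_fst hT
    have key : ∀ a : T.Dart, (a.headInd u - a.headInd w) ^ 2 =
        (a.headInd v - a.headInd w) ^ 2 + ((if a = b then 1 else 0) +
          (if a = b.symm then 1 else 0)) := by
      intro a
      have hbs : b ≠ b.symm := b.symm_ne.symm
      by_cases h₁ : a = b
      · rw [h₁, Dart.headInd_eq_one hbw, Dart.headInd_eq_one hbv, Dart.headInd_eq_zero hbu,
          if_pos rfl, if_neg hbs]
        norm_num
      · by_cases h₂ : a = b.symm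
        · rw [h₂, Dart.headInd_symm hT, Dart.headInd_symm hT, Dart.headInd_symm hT,
            Dart.headInd_eq_one hbw, Dart.headInd_eq_one hbv, Dart.headInd_eq_zero hbu,
            if_pos rfl, if_neg hbs.symm]
          norm_num
        · rw [if_neg h₁, if_neg h₂, a.headInd_congr h, add_zero, add_zero]
          intro he
          rcases (dart_edge_eq_iff b a).1 he with h' | h'
          · exact h₁ h'.symm
          · exact h₂ (by rw [h', Dart.symm_symm])
    rw [Finset.sum_congr rfl fun a _ => key a, Finset.sum_add_distrib, ← ih hp.1,
      Finset.sum_add_distrib, Finset.sum_ite_eq', Finset.sum_ite_eq', Walk.length_cons]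
    simp only [Finset.mem_univ, if_true]
    push_cast
    ring

theorem IsTree.two_mul_dist_eq_sum (hT : T.IsTree) (v w : V) :
    2 * (T.dist v w : ℤ) = ∑ a : T.Dart, (a.headInd v - a.headInd w) ^ 2 := by
  obtain ⟨p, hp, hlen⟩ := hT.connected.exists_path_of_dist v w
  rw [← hlen, hp.two_mul_length_eq_sum hT]

/-- The number of edges separating `{w, x}` from `{y, z}`. -/
noncomputable def separation (T : SimpleGraph V) [DecidableRel T.Adj] (w x y z : V) : ℤ :=
  ∑ a : T.Dart, a.headInd w * a.headInd x * (a.symm.headInd y * a.symm.headInd z)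

theorem separation_nonneg (w x y z : V) : 0 ≤ T.separation w x y z := by
  refine Finset.sum_nonneg fun a _ => ?_
  have h : ∀ (b : T.Dart) v, 0 ≤ b.headInd v := fun b v => by
    unfold Dart.headInd; split_ifs <;> norm_num
  have := h a w; have := h a x; have := h a.symm y; have := h a.symm z
  positivity

theorem exists_of_separation_ne_zero (hT : T.IsTree) {w x y z : V}
    (h : T.separation w x y z ≠ 0) :
    ∃ a : T.Dart, a.HeadSide w ∧ a.HeadSide x ∧ ¬ a.HeadSide y ∧ ¬ a.HeadSide z := by
  obtain ⟨a, -, ha⟩ := Finset.exists_ne_zero_of_sum_ne_zero h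
  have H : ∀ {b : T.Dart} {v}, b.headInd v ≠ 0 → b.HeadSide v := fun {b v} hb => by
    by_contra hc
    exact hb (Dart.headInd_eq_zero hc)
  refine ⟨a, H ?_, H ?_, (a.headSide_symm_iff hT y).1 (H ?_), (a.headSide_symm_iff hT z).1 (H ?_)⟩
  all_goals
    intro h0
    simp [h0] at ha

theorem separation_eq_zero_or (hT : T.IsTree) (w x y z : V) :
    T.separation w x y z = 0 ∨ T.separation w y x z = 0 := by
  by_contra! h
  obtain ⟨a, h₁, h₂, h₃, h₄⟩ := exists_of_separation_ne_zero hT h.1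
  obtain ⟨b, h₅, h₆, h₇, h₈⟩ := exists_of_separation_ne_zero hT h.2
  exact Dart.not_crossing hT h₁ h₂ h₃ h₄ h₅ h₇ h₆ h₈

theorem separation_swap (w x y z : V) : T.separation w x z y = T.separation w x y z := by
  unfold separation
  exact Finset.sum_congr rfl fun a _ => by ring

/-- Averaging over a dart and its reverse puts the count in a form comparable with the distance
formula dart by dart. -/
theorem two_mul_separation (hT : T.IsTree) (w x y z : V) :
    2 * T.separation w x y z = ∑ a : T.Dart,
      (a.headInd w * a.headInd x * ((1 - a.headInd y) * (1 - a.headInd z)) +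
        (1 - a.headInd w) * (1 - a.headInd x) * (a.headInd y * a.headInd z)) := by
  rw [Finset.sum_add_distrib, two_mul]
  congr 1
  · exact Finset.sum_congr rfl fun a _ => by simp only [Dart.headInd_symm hT]
  · rw [separation, ← Dart.sum_symm]
    exact Finset.sum_congr rfl fun a _ => by
      simp only [Dart.symm_symm, Dart.headInd_symm hT]

theorem dist_add_dist_sub (hT : T.IsTree) (w x y z : V) :
    (T.dist w y + T.dist x z : ℤ) - (T.dist w x + T.dist y z) =
      2 * T.separation w x y z - 2 * T.separation w y x z := by
  suffices h : 2 * (T.dist w y : ℤ) + 2 * T.dist x z - (2 * T.dist w x + 2 * T.dist y z) =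
      2 * (2 * T.separation w x y z - 2 * T.separation w y x z) by linarith
  simp only [hT.two_mul_dist_eq_sum, two_mul_separation hT, ← Finset.sum_add_distrib,
    ← Finset.sum_sub_distrib, Finset.mul_sum]
  refine Finset.sum_congr rfl fun a _ => ?_
  have h : ∀ v, a.headInd v = 0 ∨ a.headInd v = 1 := fun v => by
    unfold Dart.headInd; split_ifs <;> simp
  rcases h w with hw | hw <;> rcases h x with hx | hx <;> rcases h y with hy | hy <;>
    rcases h z with hz | hz <;> rw [hw, hx, hy, hz] <;> norm_num

/-- By `dist_add_dist_sub`, sum plus twice separation is the same for all three pairings. At least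
two separations vanish, so this common value is the largest sum. -/
theorem IsTree.max4PCEntry_eq (hT : T.IsTree) (w x y z : V) :
    (T.max4PCEntry s(w, x) s(y, z) : ℤ) =
      T.dist w x + T.dist y z + 2 * T.separation w x y z := by
  have h₁ := dist_add_dist_sub hT w x y z
  have h₂ := dist_add_dist_sub hT w x z y
  have h₃ := separation_eq_zero_or hT w x y z
  have h₄ := separation_eq_zero_or hT w x z y
  have h₅ := separation_eq_zero_or hT w y z x
  rw [separation_swap w x y z] at h₂ h₄
  rw [separation_swap w y x z, separation_swap w z x y] at h₅
  rw [T.dist_comm (u := z)] at h₂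
  have n₁ := T.separation_nonneg w x y z
  have n₂ := T.separation_nonneg w y x z
  have n₃ := T.separation_nonneg w z x y
  simp only [max4PCEntry, Sym2.lift₂_mk]
  push_cast
  rcases max_cases (T.dist w y + T.dist x z : ℤ) (T.dist w z + T.dist x y) with h | h <;>
    rw [h.1]
  · rcases max_cases (T.dist w x + T.dist y z : ℤ) (T.dist w y + T.dist x z) with h' | h' <;>
      omega
  · rcases max_cases (T.dist w x + T.dist y z : ℤ) (T.dist w z + T.dist x y) with h' | h' <;>
      omega

end Dist

end SimpleGraph

/-! ### Unimodular completion over the integers -/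

namespace Matrix

variable {ι κ μ : Type*} [Fintype ι] [DecidableEq ι] [Fintype κ] [DecidableEq κ]
  [Fintype μ] [DecidableEq μ]

/-- A matrix with a left inverse can be completed by unimodular row operations: they bring it to
the identity matrix above a zero block. -/
theorem exists_GL_mul_eq_of_mul_eq_one {U : Matrix ι κ ℤ} {W : Matrix κ ι ℤ}
    (h : W * U = 1) (g : ι ≃ κ ⊕ μ) :
    ∃ P : GL ι ℤ, ∀ i k, ((P : Matrix ι ι ℤ) * U) i k = if g i = Sum.inl k then 1 else 0 := by
  classical
  have hWU : ∀ a, W *ᵥ (U *ᵥ a) = a := fun a => by rw [mulVec_mulVec, h, one_mulVec]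
  let K := LinearMap.ker W.mulVecLin
  -- `U * W` is idempotent, so the lattice is the image of `U` plus the kernel of `W`; a basis of
  -- the kernel completes the columns of `U`.
  let φ : ((κ → ℤ) × K) ≃ₗ[ℤ] (ι → ℤ) :=
    { toFun := fun c => U *ᵥ c.1 + c.2
      invFun := fun v => (W *ᵥ v, ⟨v - U *ᵥ (W *ᵥ v), by
        rw [LinearMap.mem_ker, mulVecLin_apply, mulVec_sub, hWU, sub_self]⟩)
      map_add' := fun c c' => by
        simp only [Prod.fst_add, Prod.snd_add, mulVec_add, Submodule.coe_add]
        abel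
      map_smul' := fun r c => by
        simp only [Prod.smul_fst, Prod.smul_snd, mulVec_smul, Submodule.coe_smul, smul_add,
          RingHom.id_apply]
      left_inv := fun c => by
        have hc : W *ᵥ (c.2 : ι → ℤ) = 0 := c.2.2
        ext i
        · simp [mulVec_add, hWU, hc]
        · simp [mulVec_add, hWU, hc]
      right_inv := fun v => by simp }
  have hfin : Module.finrank ℤ K = Fintype.card μ := by
    have h₁ := φ.finrank_eq
    rw [Module.finrank_prod, Module.finrank_fintype_fun_eq_card,
      Module.finrank_fintype_fun_eq_card, Fintype.card_congr g, Fintype.card_sum] at h₁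
    omega
  let bK : Module.Basis μ ℤ K := (Module.finBasisOfFinrankEq ℤ K hfin).reindex
    (Fintype.equivFin μ).symm
  let b : Module.Basis ι ℤ (ι → ℤ) := (((Pi.basisFun ℤ κ).prod bK).map φ).reindex g.symm
  have hb : ∀ k, b (g.symm (Sum.inl k)) = U.col k := fun k => by
    simp [b, φ]
  refine ⟨⟨LinearMap.toMatrix' b.equivFun.toLinearMap,
    LinearMap.toMatrix' b.equivFun.symm.toLinearMap, ?_, ?_⟩, fun i k => ?_⟩
  · rw [← LinearMap.toMatrix'_comp]; simp
  · rw [← LinearMap.toMatrix'_comp]; simp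
  · have : ((LinearMap.toMatrix' b.equivFun.toLinearMap) * U) i k =
        (LinearMap.toMatrix' b.equivFun.toLinearMap *ᵥ U.col k) i := rfl
    rw [show ((_ : GL ι ℤ) : Matrix ι ι ℤ) = LinearMap.toMatrix' b.equivFun.toLinearMap from rfl,
      this, LinearMap.toMatrix'_mulVec, ← hb]
    simp only [LinearEquiv.coe_coe, Module.Basis.equivFun_self, Equiv.symm_apply_eq]
    exact if_congr (eq_comm) rfl rfl

/-- If `M = U * diagonal D * Vᵀ` where `U` and `V` have left inverses, then `M` is equivalent
to `D` padded with zeros. -/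
theorem exists_GL_mul_mul_eq_diagonal {U V : Matrix ι κ ℤ} {W X : Matrix κ ι ℤ}
    (hU : W * U = 1) (hV : X * V = 1) (D : κ → ℤ) (g : ι ≃ κ ⊕ μ) :
    ∃ P Q : GL ι ℤ, (P : Matrix ι ι ℤ) * (U * diagonal D * Vᵀ) * (Q : Matrix ι ι ℤ) =
      diagonal fun i => Sum.elim D (fun _ => 0) (g i) := by
  obtain ⟨P, hP⟩ := exists_GL_mul_eq_of_mul_eq_one hU g
  obtain ⟨Q, hQ⟩ := exists_GL_mul_eq_of_mul_eq_one hV g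
  refine ⟨P, ⟨(Q : Matrix ι ι ℤ)ᵀ, ((Q⁻¹ : GL ι ℤ) : Matrix ι ι ℤ)ᵀ, ?_, ?_⟩, ?_⟩
  · rw [← transpose_mul, ← Units.val_mul, inv_mul_cancel, Units.val_one, transpose_one]
  · rw [← transpose_mul, ← Units.val_mul, mul_inv_cancel, Units.val_one, transpose_one]
  · change (P : Matrix ι ι ℤ) * (U * diagonal D * Vᵀ) * (Q : Matrix ι ι ℤ)ᵀ = _
    rw [show (P : Matrix ι ι ℤ) * (U * diagonal D * Vᵀ) * (Q : Matrix ι ι ℤ)ᵀ =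
      (P : Matrix ι ι ℤ) * U * diagonal D * ((Q : Matrix ι ι ℤ) * V)ᵀ by
        rw [transpose_mul]; simp only [Matrix.mul_assoc]]
    ext i j
    rw [mul_apply]
    simp only [mul_diagonal, transpose_apply, hP, hQ, diagonal_apply]
    rcases hi : g i with k | m
    · rw [Finset.sum_eq_single k]
      · by_cases hij : i = j
        · subst hij; simp [hi]
        · have : g j ≠ Sum.inl k := fun hj => hij (g.injective (hi.trans hj.symm))
          simp [hij, this]
      · intro k' _ hk'
        simp [hk'.symm]
      · simp
    · simp

end Matrix

/-- A list made of three constant blocks enumerates any family with the same values and the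
same multiplicities. -/
theorem exists_equiv_get_replicate {α β γ R : Type*} [Fintype α] [Fintype β] [Fintype γ]
    {a b c : ℕ} (ha : Fintype.card α = a) (hb : Fintype.card β = b) (hc : Fintype.card γ = c)
    (x y z : R) :
    ∃ e : (α ⊕ β) ⊕ γ ≃ Fin (List.replicate a x ++ List.replicate b y ++
        List.replicate c z).length,
      ∀ i, (List.replicate a x ++ List.replicate b y ++ List.replicate c z).get (e i) =
        Sum.elim (Sum.elim (fun _ => x) (fun _ => y)) (fun _ => z) i := by
  refine ⟨((Equiv.sumCongr (Equiv.sumCongr (Fintype.equivFinOfCardEq ha)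
    (Fintype.equivFinOfCardEq hb)) (Fintype.equivFinOfCardEq hc)).trans
    ((Equiv.sumCongr finSumFinEquiv (Equiv.refl _)).trans finSumFinEquiv)).trans
    (finCongr (by simp [add_assoc])), ?_⟩
  rintro ((i | i) | i)
  · simp
  · simp
  · have h : ¬ a + b + (Fintype.equivFinOfCardEq hc i : ℕ) < a := by omega
    have h' : ¬ a + b + (Fintype.equivFinOfCardEq hc i : ℕ) - a < b := by omega
    simp [List.getElem_append, h, h']

open scoped Matrix

/-! ### Functions on pairs of vertices -/

namespace SimpleGraph

variable {V : Type*} {T : SimpleGraph V}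

/-- Whether both vertices of a pair lie on the head side of a dart, as an integer. -/
noncomputable def Dart.pairInd (a : T.Dart) : Sym2 V → ℤ :=
  Sym2.lift ⟨fun w x => a.headInd w * a.headInd x, fun _ _ => mul_comm _ _⟩

@[simp]
theorem Dart.pairInd_mk (a : T.Dart) (w x : V) :
    a.pairInd s(w, x) = a.headInd w * a.headInd x := rfl

/-- The distance between the two vertices of a pair. -/
noncomputable def pairDist (T : SimpleGraph V) : Sym2 V → ℤ :=
  Sym2.lift ⟨fun w x => (T.dist w x : ℤ), fun _ _ => congrArg Nat.cast T.dist_comm⟩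

@[simp]
theorem pairDist_mk (w x : V) : T.pairDist s(w, x) = T.dist w x := rfl

theorem Dart.headInd_sub_headInd [DecidableEq V] (hT : T.IsTree) (a : T.Dart) {y z : V}
    (h : T.Adj z y) :
    a.headInd z - a.headInd y = (if a.symm = ⟨(z, y), h⟩ then 1 else 0) -
      (if a = ⟨(z, y), h⟩ then 1 else 0) := by
  by_cases h₁ : a = ⟨(z, y), h⟩
  · have hz : ¬ a.HeadSide z := by have := a.not_headSide_fst hT; rwa [h₁] at this ⊢
    have hy : a.HeadSide y := by have := a.headSide_snd; rwa [h₁] at this ⊢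
    rw [headInd_eq_zero hz, headInd_eq_one hy, if_pos h₁, if_neg (h₁ ▸ a.symm_ne)]
  · by_cases h₂ : a.symm = ⟨(z, y), h⟩
    · have hz : ¬ a.symm.HeadSide z := by
        have := a.symm.not_headSide_fst hT; rwa [h₂] at this ⊢
      have hy : a.symm.HeadSide y := by have := a.symm.headSide_snd; rwa [h₂] at this ⊢
      rw [headSide_symm_iff hT] at hz hy
      rw [headInd_eq_one (not_not.1 hz), headInd_eq_zero hy, if_neg h₁, if_pos h₂]
    · rw [if_neg h₁, if_neg h₂, a.headInd_congr h, sub_self, sub_self]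
      intro he
      rcases (dart_edge_eq_iff (⟨(z, y), h⟩ : T.Dart) a).1 he with h' | h'
      · exact h₁ h'.symm
      · exact h₂ h'.symm

/-- Moving from `y` to `z` affects only the dart `z → y` and its reverse. The neighbour `x` of `y`
lies on the head side of the former, so only that indicator changes. -/
theorem Dart.pairInd_sub_pairInd [DecidableEq V] (hT : T.IsTree) (a : T.Dart) {x y z : V}
    (hxy : T.Adj x y) (hzy : T.Adj z y) (hxz : x ≠ z) :
    a.pairInd s(x, z) - a.pairInd s(x, y) = -if a = ⟨(z, y), hzy⟩ then 1 else 0 := by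
  rw [pairInd_mk, pairInd_mk, ← mul_sub, headInd_sub_headInd hT a hzy]
  have hx : ∀ b : T.Dart, b = ⟨(z, y), hzy⟩ → b.HeadSide x := by
    rintro b rfl
    refine (headSide_congr _ hxy ?_).2 (headSide_snd _)
    simp only [Dart.edge_mk, ne_eq, Sym2.eq_iff]
    rintro (⟨h, -⟩ | ⟨-, h⟩)
    · exact hxz h
    · exact hzy.ne h.symm
  by_cases h₁ : a = ⟨(z, y), hzy⟩
  · rw [if_pos h₁, if_neg (h₁ ▸ a.symm_ne), headInd_eq_one (hx a h₁)]
    norm_num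
  · by_cases h₂ : a.symm = ⟨(z, y), hzy⟩
    · have := hx _ h₂
      rw [headSide_symm_iff hT] at this
      rw [headInd_eq_zero this, if_neg h₁]
      norm_num
    · rw [if_neg h₁, if_neg h₂]
      norm_num

theorem IsTree.dist_eq_two (hT : T.IsTree) {x y z : V} (hxy : T.Adj x y) (hzy : T.Adj z y)
    (hxz : x ≠ z) : T.dist x z = 2 := by
  have h := hT.dist_eq_dist_add_one_of_adj x hzy
  rw [dist_eq_one_iff_adj.2 hxy] at h
  have : T.dist x z ≠ 0 := (hT.connected.pos_dist_of_ne hxz).ne'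
  omega

/-! ### Leaves and inner darts -/

section Leaves

variable [Fintype V] [DecidableRel T.Adj]

theorem Dart.eq_snd_of_headSide {a : T.Dart} (ha : T.degree a.snd = 1) {v : V}
    (hv : a.HeadSide v) : v = a.snd := by
  obtain ⟨p⟩ := hv
  cases p with
  | nil => rfl
  | @cons _ w _ h p =>
    rw [deleteEdges_adj] at h
    obtain ⟨u, -, hu⟩ := degree_eq_one_iff_existsUnique_adj.1 ha
    have : w = a.fst := (hu w h.1).trans (hu a.fst a.adj.symm).symm
    exact absurd (by rw [this, Sym2.eq_swap]; rfl) h.2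

/-- Two adjacent leaves would be the whole tree, each side of their edge being a single vertex. -/
theorem IsTree.degree_ne_one_of_adj (hT : T.IsTree) (hV : 3 ≤ Fintype.card V) {x y : V}
    (h : T.Adj x y) (hx : T.degree x = 1) : T.degree y ≠ 1 := by
  classical
  intro hy
  obtain ⟨v, hv⟩ : ∃ v, v ∉ ({x, y} : Finset V) := by
    by_contra! hc
    have := Finset.card_le_card (fun v _ => hc v : (Finset.univ : Finset V) ⊆ {x, y})
    rw [Finset.card_univ] at this
    have := Finset.card_le_two (a := x) (b := y)
    omega
  simp only [Finset.mem_insert, Finset.mem_singleton, not_or] at hv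
  rcases (⟨(x, y), h⟩ : T.Dart).headSide_or_headSide_symm hT.connected v with h' | h'
  · exact hv.2 (Dart.eq_snd_of_headSide hy h')
  · exact hv.1 (Dart.eq_snd_of_headSide hx h')

theorem exists_adj_ne_of_degree_ne_one {x y : V} (h : T.Adj x y) (hy : T.degree y ≠ 1) :
    ∃ z, T.Adj z y ∧ z ≠ x := by
  by_contra! hc
  exact hy (degree_eq_one_iff_existsUnique_adj.2 ⟨x, h.symm, fun z hz => hc z hz.symm⟩)

variable (T) in
/-- The darts of the edges that are not incident to a leaf. -/
abbrev InnerDart : Type _ := {a : T.Dart // T.degree a.fst ≠ 1 ∧ T.degree a.snd ≠ 1}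

variable (T) in
/-- Reversal of inner darts. -/
def innerDartSymm : Equiv.Perm T.InnerDart :=
  Function.Involutive.toPerm (fun a => ⟨a.1.symm, a.2.2, a.2.1⟩)
    fun a => Subtype.ext a.1.symm_symm

@[simp]
theorem coe_innerDartSymm (a : T.InnerDart) : (T.innerDartSymm a).1 = a.1.symm := rfl

/-- Of the `2(n - 1)` darts, `p` start at a leaf, `p` end at one, and none does both. -/
theorem card_innerDart [DecidableEq V] (hT : T.IsTree) (hV : 3 ≤ Fintype.card V) :
    Fintype.card T.InnerDart = 2 * (Fintype.card V -
      (Finset.univ.filter fun v : V => T.degree v = 1).card - 1) := by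
  have htot : Fintype.card T.Dart + 2 = 2 * Fintype.card V := by
    rw [T.dart_card_eq_twice_card_edges, ← hT.card_edgeFinset]
    ring
  have hfst : (Finset.univ.filter fun a : T.Dart => T.degree a.fst = 1).card =
      (Finset.univ.filter fun v : V => T.degree v = 1).card := by
    rw [Finset.card_eq_sum_card_fiberwise (f := fun a : T.Dart => a.fst)
      (t := Finset.univ.filter fun v : V => T.degree v = 1) (by intro a; simp),
      Finset.card_eq_sum_ones]
    refine Finset.sum_congr rfl fun v hv => ?_
    simp only [Finset.mem_filter, Finset.mem_univ, true_and] at hv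
    rw [← hv, ← T.dart_fst_fiber_card_eq_degree v]
    congr 1
    ext a
    simp only [Finset.mem_filter, Finset.mem_univ, true_and, and_iff_right_iff_imp]
    rintro rfl
    rw [hv]
    rw [T.dart_fst_fiber_card_eq_degree a.fst, hv]
  have hsnd : (Finset.univ.filter fun a : T.Dart => T.degree a.snd = 1).card =
      (Finset.univ.filter fun a : T.Dart => T.degree a.fst = 1).card :=
    Finset.card_bij' (fun a _ => a.symm) (fun a _ => a.symm) (by simp [Dart.symm])
      (by simp [Dart.symm]) (by simp) (by simp)
  have hsub : Fintype.card T.InnerDart + ((Finset.univ.filter fun a : T.Dart =>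
      T.degree a.fst = 1) ∪ (Finset.univ.filter fun a : T.Dart => T.degree a.snd = 1)).card =
      Fintype.card T.Dart := by
    rw [Fintype.card_subtype, ← Finset.filter_or, ← Finset.card_univ,
      ← Finset.card_filter_add_card_filter_not (s := Finset.univ)
        (p := fun a : T.Dart => T.degree a.fst ≠ 1 ∧ T.degree a.snd ≠ 1)]
    congr 3
    ext a
    tauto
  rw [Finset.card_union_of_disjoint, hsnd, hfst] at hsub
  · omega
  · rw [Finset.disjoint_filter]
    exact fun a _ h => hT.degree_ne_one_of_adj hV a.adj h

theorem sum_innerDart_eq_separation {w x y z : V} (hwx : w ≠ x) (hyz : y ≠ z) :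
    ∑ a : T.InnerDart, a.1.pairInd s(w, x) * a.1.symm.pairInd s(y, z) =
      T.separation w x y z := by
  have hz : ∀ (a : T.Dart) {v v' : V}, v ≠ v' → T.degree a.snd = 1 → a.pairInd s(v, v') = 0 := by
    intro a v v' hv ha
    rw [Dart.pairInd_mk]
    by_cases h : a.HeadSide v
    · have h' : ¬ a.HeadSide v' := fun h' =>
        hv ((Dart.eq_snd_of_headSide ha h).trans (Dart.eq_snd_of_headSide ha h').symm)
      rw [Dart.headInd_eq_zero h', mul_zero]
    · rw [Dart.headInd_eq_zero h, zero_mul]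
  rw [← Finset.sum_subtype (Finset.univ.filter fun a : T.Dart =>
      T.degree a.fst ≠ 1 ∧ T.degree a.snd ≠ 1) (by simp)
      fun a => a.pairInd s(w, x) * a.symm.pairInd s(y, z)]
  refine Finset.sum_filter_of_ne fun a _ ha => ⟨fun h => ha ?_, fun h => ha ?_⟩
  · rw [hz a.symm hyz h, mul_zero]
  · rw [hz a hwx h, zero_mul]

end Leaves

/-! ### Factorization and the row lattice -/

section Factorization

variable [Fintype V] [DecidableEq V] [DecidableRel T.Adj]

variable (T) in
/-- The matrix whose columns are the constant function `1`, the distance, and the indicator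
functions of the inner darts, as functions of a pair of vertices. -/
noncomputable def pairMatrix : Matrix (VertexPair V) (Fin 2 ⊕ T.InnerDart) ℤ :=
  Matrix.of fun e => Sum.elim ![1, T.pairDist e.1] fun a => a.1.pairInd e.1

variable (T) in
/-- The involution of the columns of `pairMatrix` along which the four point matrix pairs them. -/
def columnSwap : Equiv.Perm (Fin 2 ⊕ T.InnerDart) :=
  Equiv.sumCongr (Equiv.swap 0 1) T.innerDartSymm

theorem IsTree.max4PC_eq (hT : T.IsTree) :
    T.max4PC = T.pairMatrix * Matrix.diagonal
      (Sum.elim (fun _ => 1) (fun _ => 2) : Fin 2 ⊕ T.InnerDart → ℤ) *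
      (T.pairMatrix.submatrix id T.columnSwap)ᵀ := by
  ext ⟨e, he⟩ ⟨f, hf⟩
  induction e with | h w x
  induction f with | h y z
  rw [Sym2.mk_isDiag_iff] at he hf
  rw [Matrix.mul_apply, Fintype.sum_sum_type, Fin.sum_univ_two]
  simp only [max4PC, Matrix.of_apply, hT.max4PCEntry_eq, Matrix.mul_diagonal,
    Matrix.transpose_apply, Matrix.submatrix_apply]
  rw [← sum_innerDart_eq_separation he hf, Finset.mul_sum]
  simp only [pairMatrix, columnSwap, coe_innerDartSymm, Matrix.of_apply, Equiv.sumCongr_apply,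
    Sum.map_inl, Sum.map_inr, Sum.elim_inl, Sum.elim_inr, id, Equiv.swap_apply_left,
    Equiv.swap_apply_right, Matrix.cons_val_zero,
    Matrix.cons_val_one, pairDist_mk]
  congr 1
  · ring
  · exact Finset.sum_congr rfl fun a _ => by ring

theorem pairMatrix_row_mem_range (e : VertexPair V) :
    T.pairMatrix.row e ∈ LinearMap.range T.pairMatrix.vecMulLinear :=
  ⟨Pi.single e 1, by simp⟩

theorem pairMatrix_row_sub_row (hT : T.IsTree) {x y z : V} (hxy : T.Adj x y) (hzy : T.Adj z y)
    (hxz : x ≠ z) :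
    T.pairMatrix.row ⟨s(x, z), hxz⟩ - T.pairMatrix.row ⟨s(x, y), hxy.ne⟩ =
      Sum.elim ![0, 1] fun a => -if a.1 = ⟨(z, y), hzy⟩ then 1 else 0 := by
  ext k
  rcases k with k | a
  · fin_cases k
    · simp [pairMatrix]
    · simp [pairMatrix, hT.dist_eq_two hxy hzy hxz, dist_eq_one_iff_adj.2 hxy]
  · exact a.1.pairInd_sub_pairInd hT hxy hzy hxz

theorem range_vecMulLinear_pairMatrix (hT : T.IsTree) (hV : 3 ≤ Fintype.card V) :
    LinearMap.range T.pairMatrix.vecMulLinear = ⊤ := by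
  set R := LinearMap.range T.pairMatrix.vecMulLinear with hR
  have hrow : ∀ e, T.pairMatrix.row e ∈ R := pairMatrix_row_mem_range
  have : Nontrivial V := Fintype.one_lt_card_iff_nontrivial.1 (by omega)
  obtain ⟨z, hz⟩ := hT.exists_vert_degree_one_of_nontrivial
  obtain ⟨y, hzy, -⟩ := degree_eq_one_iff_existsUnique_adj.1 hz
  obtain ⟨x, hxy, hxz⟩ := exists_adj_ne_of_degree_ne_one hzy (hT.degree_ne_one_of_adj hV hzy hz)
  -- As `z` is a leaf, the dart `z → y` is not inner, and the row difference is the distance unit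
  -- vector alone.
  have hdist : (Pi.single (Sum.inl 1) 1 : Fin 2 ⊕ T.InnerDart → ℤ) ∈ R := by
    have := R.sub_mem (hrow _) (hrow _) |> (pairMatrix_row_sub_row hT hxy hzy hxz ▸ ·)
    convert this using 1
    ext k
    rcases k with k | a
    · fin_cases k <;> simp
    · have : a.1 ≠ ⟨(z, y), hzy⟩ := fun h => a.2.1 (by rw [h]; exact hz)
      simp [this]
  have hinner : ∀ a, (Pi.single (Sum.inr a) 1 : Fin 2 ⊕ T.InnerDart → ℤ) ∈ R := by
    rintro ⟨⟨⟨z, y⟩, hzy⟩, ha⟩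
    obtain ⟨x, hxy, hxz⟩ := exists_adj_ne_of_degree_ne_one hzy ha.2
    have := R.sub_mem (hrow _) (hrow _) |> (pairMatrix_row_sub_row hT hxy hzy hxz ▸ ·)
    convert R.sub_mem hdist this using 1
    ext k
    rcases k with k | a
    · fin_cases k <;> simp
    · simp [Pi.single_apply, Subtype.ext_iff]
  -- Any edge's row has constant and distance entries 1; removing its distance and dart parts leaves
  -- this vector.
  have hone : (Pi.single (Sum.inl 0) 1 : Fin 2 ⊕ T.InnerDart → ℤ) ∈ R := by
    have h := R.sub_mem (hrow ⟨s(z, y), hzy.ne⟩) (R.add_mem hdist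
      (R.sum_mem fun a (_ : a ∈ Finset.univ) => R.smul_mem (a.1.pairInd s(z, y)) (hinner a)))
    convert h using 1
    ext k
    rcases k with k | a
    · fin_cases k <;> simp [pairMatrix, Finset.sum_apply, dist_eq_one_iff_adj.2 hzy]
    · simp [pairMatrix, Finset.sum_apply, Pi.single_apply]
  rw [eq_top_iff]
  intro v _
  rw [pi_eq_sum_univ' v]
  refine R.sum_mem fun k _ => R.smul_mem _ ?_
  rcases k with k | a
  · fin_cases k
    · exact hone
    · exact hdist
  · exact hinner a

theorem exists_mul_pairMatrix_eq_one (hT : T.IsTree) (hV : 3 ≤ Fintype.card V) :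
    ∃ W : Matrix (Fin 2 ⊕ T.InnerDart) (VertexPair V) ℤ, W * T.pairMatrix = 1 := by
  have h := LinearMap.range_eq_top.1 (range_vecMulLinear_pairMatrix hT hV)
  choose c hc using fun k => h (Pi.single k 1)
  refine ⟨Matrix.of c, ?_⟩
  ext k l
  have := congrFun (hc k) l
  rw [Matrix.one_apply]
  simp only [Pi.single_apply, eq_comm (a := l)] at this
  exact this

end Factorization

end SimpleGraph

/-! ### Assembling the Smith normal form -/

theorem mainTheorem3 {V : Type*} [Fintype V] [DecidableEq V] (T : SimpleGraph V)
    [DecidableRel T.Adj] (hT : T.IsTree) (n p : ℕ) (hn : Fintype.card V = n) (hn3 : 3 ≤ n)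
    (hp : (Finset.univ.filter fun v : V => T.degree v = 1).card = p) :
    T.max4PC.HasInvariantFactors
      (List.replicate 2 (1 : ℤ) ++ List.replicate (2 * (n - p - 1)) (2 : ℤ) ++
        List.replicate (n.choose 2 - 2 * (n - p)) (0 : ℤ)) := by
  subst hn hp
  set m := 2 * (Fintype.card V - (Finset.univ.filter fun v : V => T.degree v = 1).card - 1)
    with hm
  have hcard : Fintype.card (VertexPair V) = (Fintype.card V).choose 2 :=
    Sym2.card_subtype_not_diag
  have hinner : Fintype.card T.InnerDart = m := T.card_innerDart hT hn3
  obtain ⟨W, hW⟩ := T.exists_mul_pairMatrix_eq_one hT hn3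
  -- With `p < n` the subtraction `n - p - 1` is not truncated, so `2 + m = 2 * (n - p)`.
  have hlt : (Finset.univ.filter fun v : V => T.degree v = 1).card < Fintype.card V := by
    have : Nontrivial V := Fintype.one_lt_card_iff_nontrivial.1 (by omega)
    obtain ⟨z, hz⟩ := hT.exists_vert_degree_one_of_nontrivial
    obtain ⟨y, hzy, -⟩ := SimpleGraph.degree_eq_one_iff_existsUnique_adj.1 hz
    exact Finset.card_lt_univ_of_notMem (x := y)
      (by simpa using hT.degree_ne_one_of_adj hn3 hzy hz)
  -- The rank bound keeps the number of zeros from being truncated.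
  have hle : 2 + m ≤ (Fintype.card V).choose 2 := by
    have := card_le_of_surjective ℤ _
      (LinearMap.range_eq_top.1 (T.range_vecMulLinear_pairMatrix hT hn3))
    rwa [hcard, Fintype.card_sum, Fintype.card_fin, hinner] at this
  obtain ⟨g⟩ : Nonempty (VertexPair V ≃ (Fin 2 ⊕ T.InnerDart) ⊕
      Fin ((Fintype.card V).choose 2 - (2 + m))) := by
    refine Fintype.card_eq.1 ?_
    simp only [Fintype.card_sum, Fintype.card_fin, hcard, hinner]
    omega
  have hX : W.submatrix T.columnSwap id * T.pairMatrix.submatrix id T.columnSwap = 1 := by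
    rw [← Matrix.submatrix_mul _ _ _ _ _ Function.bijective_id, hW, Matrix.submatrix_one_equiv]
  obtain ⟨P, Q, hPQ⟩ := Matrix.exists_GL_mul_mul_eq_diagonal hW hX
    (Sum.elim (fun _ => 1) fun _ => 2) g
  obtain ⟨e, he⟩ := exists_equiv_get_replicate (Fintype.card_fin 2) hinner
    (γ := Fin ((Fintype.card V).choose 2 - (2 + m)))
    (c := (Fintype.card V).choose 2 -
      2 * (Fintype.card V - (Finset.univ.filter fun v : V => T.degree v = 1).card))
    (by rw [Fintype.card_fin]; omega) (1 : ℤ) 2 0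
  refine ⟨?_, ?_, ?_, P, Q, g.trans e, ?_⟩
  · rw [← Fintype.card_fin (List.length _)]
    exact Fintype.card_congr (g.trans e).symm
  · intro a ha
    simp only [List.mem_append, List.mem_replicate] at ha
    omega
  · refine List.isChain_append.2 ⟨List.isChain_append.2 ⟨?_, ?_, ?_⟩, ?_, ?_⟩
    · exact List.isChain_replicate_of_rel _ dvd_rfl
    · exact List.isChain_replicate_of_rel _ dvd_rfl
    · intro a ha b _
      rw [List.eq_of_mem_replicate (List.mem_of_mem_getLast? ha)]
      exact one_dvd b
    · exact List.isChain_replicate_of_rel _ dvd_rfl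
    · intro a _ b hb
      rw [List.eq_of_mem_replicate (List.mem_of_mem_head? hb)]
      exact dvd_zero a
  · rw [hT.max4PC_eq, hPQ]
    simp only [Equiv.trans_apply, he]
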